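/- Let $A$ be a finite alphabet. $FO[<]$ is first-order logic interpreted in finite words over $A$ (including the empty word, in which every existentially quantified sentence is false): variables range over the positions of the word, $<$ is the order of positions, and for each $a\in A$ there is a unary predicate $a(x)$, meaning that the letter in position $x$ is $a$. $FO^2[<,\mathrm{Bet}]$ consists of the formulas that use only two variables (which may be requantified) and are built from $x=y$, $x<y$, $a(x)$ and, for each $a\in A$, the binary predicate $a(x,y)$, interpreted as $\exists z\,(x<z\wedge z<y\wedge a(z))$. A language $L\subseteq A^*$ is definable in one of these logics if it is the set of all words in $A^*$ that satisfy some sentence of the logic. If $a,b\in A$ are distinct letters, then the language given by the regular expression $$(a(ab)^*b)^*$$ is definable in $FO[<]$ but not in $FO^2[<,\mathrm{Bet}]$. Consequently $FO^2[<,\mathrm{Bet}]$ is strictly less expressive than $FO[<]$: over every finite alphabet $A$ each language definable in $FO^2[<,\mathrm{Bet}]$ is definable in $FO[<]$, and if $A$ has at least two letters, then some language over $A$ is definable in $FO[<]$ but not in $FO^2[<,\mathrm{Bet}]$. -/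

import Mathlib

universe u

namespace WordLogic

/-! ### First-order logic `FO[<]` over words -/

/-- The relation symbols of `FO[<]` over the alphabet `A`: a unary symbol for every letter and the
binary symbol `<`. -/
inductive OrderRel (A : Type u) : ℕ → Type u
  | letter (a : A) : OrderRel A 1
  | lt : OrderRel A 2

/-- The relational signature of `FO[<]` over the alphabet `A`. -/
def orderSignature (A : Type u) : FirstOrder.Language.{0, u} where
  Functions := fun _ => Empty
  Relations := OrderRel A

/-- The positions of a word. -/
def Position {A : Type u} (w : List A) : Type := Fin w.length

/-- A word as a structure: the universe is the set of its positions, `a(x)` says that the letter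
in position `x` is `a`, and `<` is the usual order.  The empty word has the empty universe. -/
instance positionStructure {A : Type u} (w : List A) :
    (orderSignature A).Structure (Position w) where
  funMap := fun f _ => Empty.elim f
  RelMap := fun {_} R =>
    match R with
    | OrderRel.letter a => fun x => w.get (x 0) = a
    | OrderRel.lt => fun x => (show Fin w.length from x 0) < (show Fin w.length from x 1)

/-- A language is definable in `FO[<]` if it is the set of words that satisfy some first-order
sentence. -/
def FODefinable {A : Type u} (L : Language A) : Prop :=
  ∃ φ : (orderSignature A).Sentence, ∀ w : List A, w ∈ L ↔ φ.Realize (Position w)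

/-! ### Two-variable logic with the between predicates, `FO²[<,Bet]` -/

/-- Formulas of `FO²[<,Bet]` over the alphabet `A`.  The two variables are the elements of `Fin 2`;
they may be quantified repeatedly. -/
inductive BetFormula (A : Type u) : Type u
  | falsum : BetFormula A
  | eq (x y : Fin 2) : BetFormula A
  | lt (x y : Fin 2) : BetFormula A
  | letter (a : A) (x : Fin 2) : BetFormula A
  | between (a : A) (x y : Fin 2) : BetFormula A
  | neg (φ : BetFormula A) : BetFormula A
  | and (φ ψ : BetFormula A) : BetFormula A
  | ex (x : Fin 2) (φ : BetFormula A) : BetFormula A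

namespace BetFormula

/-- The free variables of a formula. -/
def freeVars {A : Type u} : BetFormula A → Finset (Fin 2)
  | falsum => ∅
  | eq x y => {x, y}
  | lt x y => {x, y}
  | letter _ x => {x}
  | between _ x y => {x, y}
  | neg φ => φ.freeVars
  | and φ ψ => φ.freeVars ∪ ψ.freeVars
  | ex x φ => φ.freeVars.erase x

/-- `φ.Holds w v`: the word `w` satisfies `φ` under the valuation `v`.  Positions are the numbers
`i < w.length`, and quantifiers range over positions only.  (Valuations take values in `ℕ` so that
they exist for the empty word, too; on sentences they play no role.) -/
def Holds {A : Type u} (w : List A) : BetFormula A → (Fin 2 → ℕ) → Prop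
  | falsum, _ => False
  | eq x y, v => v x = v y
  | lt x y, v => v x < v y
  | letter a x, v => w[v x]? = some a
  | between a x y, v => ∃ z, v x < z ∧ z < v y ∧ w[z]? = some a
  | neg φ, v => ¬ φ.Holds w v
  | and φ ψ, v => φ.Holds w v ∧ ψ.Holds w v
  | ex x φ, v => ∃ i, i < w.length ∧ φ.Holds w (Function.update v x i)

/-- The truth of a formula depends only on the values of its free variables. -/
theorem holds_congr {A : Type u} (w : List A) (φ : BetFormula A) :
    ∀ v v' : Fin 2 → ℕ, (∀ x ∈ φ.freeVars, v x = v' x) → (φ.Holds w v ↔ φ.Holds w v') := by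
  induction φ with
  | falsum => intro v v' _; rfl
  | eq x y => intro v v' h; simp [freeVars] at h; simp [Holds, h]
  | lt x y => intro v v' h; simp [freeVars] at h; simp [Holds, h]
  | letter a x => intro v v' h; simp [freeVars] at h; simp [Holds, h]
  | between a x y => intro v v' h; simp [freeVars] at h; simp [Holds, h]
  | neg φ ih => intro v v' h; exact not_congr (ih v v' h)
  | and φ ψ ih₁ ih₂ =>
    intro v v' h
    exact and_congr (ih₁ v v' fun x hx => h x (Finset.mem_union_left _ hx))
      (ih₂ v v' fun x hx => h x (Finset.mem_union_right _ hx))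
  | ex x φ ih =>
    intro v v' h
    refine exists_congr fun i => and_congr_right fun _ => ih _ _ fun y hy => ?_
    by_cases hyx : y = x
    · subst hyx; simp
    · simpa [Function.update_of_ne hyx] using h y (Finset.mem_erase.2 ⟨hyx, hy⟩)

/-- A sentence is a formula without free variables. -/
def IsSentence {A : Type u} (φ : BetFormula A) : Prop := φ.freeVars = ∅

end BetFormula

/-- A language is definable in `FO²[<,Bet]` if it is the set of words that satisfy some sentence
of this logic. -/
def BetDefinable {A : Type u} (L : Language A) : Prop :=
  ∃ φ : BetFormula A, φ.IsSentence ∧ ∀ w : List A, w ∈ L ↔ ∀ v : Fin 2 → ℕ, φ.Holds w v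

/-- The language of the regular expression `(a(ab)*b)*`. -/
def nestedLanguage {A : Type u} (a b : A) : Language A :=
  (RegularExpression.star
    (RegularExpression.char a *
      RegularExpression.star (RegularExpression.char a * RegularExpression.char b) *
      RegularExpression.char b)).matches'

end WordLogic

/-! Definability of the nested language. Read `a` as a step up and `b` as a step down: the words of
`(a(ab)*b)*` are the paths from 0 to 0 with heights in {0, 1, 2} (`isDescent_zero_iff_mem`). In such
a path `aa` leads to height 2 and `bb` to height 0, and between double letters the path alternates.
So the height after a position depends only on the letter there and on the kind of the last double
letter, and validity of the path becomes a first-order condition (`mem_nestedLanguage_iff`).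

Non-definability. When every factor of length three contains `a` and `b` and no other letter, the
between predicates on a pair more than 3 apart reveal only its order. In the two-pebble
Ehrenfeucht-Fraïssé game a distant move can then be answered by any position on the correct side
with the same neighbourhood, and a close move by the same displacement. Hence two words that agree
near both ends and have only factors of one periodic pattern as windows cannot be told apart by
sentences of small depth (`SimilarAt.forth`, `Resembles.backAndForth`, `Resembles.holds_iff`).

For the pattern of period `(ab)ᴺa(ab)ᴺb`, compare `2K` periods with the same word that has an extra
half period `(ab)ᴺa` in the middle. The first word lies in the language; the second has one `a` too
many. A window of length `2N + 1` is too short to notice that two successive markers are both `a`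
(`resembles_brokenPattern`).

The inclusion of the logics is a direct translation, with a third variable for the between
predicates (`BetFormula.foRel`). -/

namespace WordLogic

/-! ### Definable relations on positions -/

/-- A position as a number. -/
def Position.index {A : Type u} {w : List A} (i : Position w) : ℕ := Fin.val i

theorem Position.index_lt {A : Type u} {w : List A} (i : Position w) : i.index < w.length :=
  Fin.isLt i

/-- The position with a given number. -/
def Position.ofLt {A : Type u} {w : List A} {i : ℕ} (hi : i < w.length) : Position w :=
  Fin.mk i hi

/-- The symbol for a letter. -/
def letterSymbol {A : Type u} (a : A) : (orderSignature A).Relations 1 := OrderRel.letter a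

/-- The symbol for the order. -/
def ltSymbol (A : Type u) : (orderSignature A).Relations 2 := OrderRel.lt

/-- A family of relations on the positions of words, with arguments named by natural numbers, is
definable in `FO[<]` if some first-order formula defines it in every word. -/
def FORel {A : Type u} (P : List A → (ℕ → ℕ) → Prop) : Prop :=
  ∃ φ : (orderSignature A).Formula ℕ, ∀ (w : List A) (v : ℕ → Position w),
    φ.Realize v ↔ P w fun n => (v n).index

namespace FORel

variable {A : Type u} {P Q : List A → (ℕ → ℕ) → Prop}

/-- Only valuations by actual positions matter, so equivalences may use `v n < w.length`. -/
theorem congr (h : FORel P)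
    (hPQ : ∀ (w : List A) (v : ℕ → ℕ), (∀ n, v n < w.length) → (P w v ↔ Q w v)) : FORel Q := by
  obtain ⟨φ, hφ⟩ := h
  exact ⟨φ, fun w v => (hφ w v).trans (hPQ w _ fun n => (v n).index_lt)⟩

theorem falsum : FORel (fun (_ : List A) _ => False) :=
  ⟨⊥, fun _ _ => Iff.rfl⟩

theorem neg (h : FORel P) : FORel fun w v => ¬ P w v := by
  obtain ⟨φ, hφ⟩ := h
  refine ⟨φ.not, fun w v => ?_⟩
  rw [FirstOrder.Language.Formula.realize_not, hφ]

theorem and (hP : FORel P) (hQ : FORel Q) : FORel fun w v => P w v ∧ Q w v := by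
  obtain ⟨φ, hφ⟩ := hP
  obtain ⟨ψ, hψ⟩ := hQ
  refine ⟨φ ⊓ ψ, fun w v => ?_⟩
  rw [FirstOrder.Language.Formula.realize_inf, hφ, hψ]

theorem or (hP : FORel P) (hQ : FORel Q) : FORel fun w v => P w v ∨ Q w v :=
  (hP.neg.and hQ.neg).neg.congr fun w v _ => by tauto

theorem imp (hP : FORel P) (hQ : FORel Q) : FORel fun w v => P w v → Q w v :=
  (hP.and hQ.neg).neg.congr fun w v _ => by tauto

theorem ex (x : ℕ) (h : FORel P) :
    FORel fun w v => ∃ i, i < w.length ∧ P w (Function.update v x i) := by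
  obtain ⟨φ, hφ⟩ := h
  refine ⟨(FirstOrder.Language.BoundedFormula.relabel (n := 1) (k := 0)
    (fun y : ℕ => if y = x then Sum.inr 0 else Sum.inl y) φ).ex, fun w v => ?_⟩
  have key : ∀ i : Position w,
      (FirstOrder.Language.BoundedFormula.relabel (n := 1) (k := 0)
        (fun y : ℕ => if y = x then (Sum.inr 0 : ℕ ⊕ Fin 1) else Sum.inl y) φ).Realize
        v (Fin.snoc default i) ↔ P w (Function.update (fun n => (v n).index) x i.index) := by
    intro i
    rw [FirstOrder.Language.BoundedFormula.realize_relabel]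
    have h1 := hφ w (Function.update v x i)
    have h2 : (fun n => (Function.update v x i n).index) =
        Function.update (fun n => (v n).index) x i.index := by
      funext n
      by_cases hn : n = x
      · subst hn; simp
      · simp [Function.update_of_ne hn]
    rw [h2] at h1
    rw [← h1, FirstOrder.Language.Formula.Realize]
    refine iff_of_eq ?_
    congr 1
    · funext n
      by_cases hn : n = x
      · subst hn
        simp [Fin.snoc]
      · simp [hn]
    · exact Subsingleton.elim _ _
  rw [FirstOrder.Language.Formula.Realize, FirstOrder.Language.BoundedFormula.realize_ex]
  constructor
  · rintro ⟨i, hi⟩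
    exact ⟨i.index, i.index_lt, (key i).1 hi⟩
  · rintro ⟨i, hi, h⟩
    exact ⟨.ofLt hi, (key (.ofLt hi)).2 h⟩

theorem all (x : ℕ) (h : FORel P) :
    FORel fun w v => ∀ i, i < w.length → P w (Function.update v x i) :=
  (h.neg.ex x).neg.congr fun w v _ => by push Not; rfl

theorem letter (a : A) (x : ℕ) : FORel fun (w : List A) v => w[v x]? = some a := by
  refine ⟨(letterSymbol a).formula₁ (FirstOrder.Language.Term.var x), fun w v => ?_⟩
  rw [FirstOrder.Language.Formula.realize_rel₁]
  refine Iff.trans ?_ (List.getElem?_eq_some_iff.trans (exists_prop_of_true (v x).index_lt)).symm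
  exact Iff.rfl

theorem lt (x y : ℕ) : FORel fun (_ : List A) v => v x < v y := by
  refine ⟨(ltSymbol A).formula₂ (FirstOrder.Language.Term.var x)
    (FirstOrder.Language.Term.var y), fun w v => ?_⟩
  rw [FirstOrder.Language.Formula.realize_rel₂]
  exact Iff.rfl

theorem eq (x y : ℕ) : FORel fun (_ : List A) v => v x = v y :=
  ((lt x y).neg.and (lt y x).neg).congr fun _ _ _ => by omega

/-- Two consecutive positions, the first one named by `x`, carry the letter `c`. -/
theorem double (c : A) (x : ℕ) :
    FORel fun w v => w[v x]? = some c ∧ w[v x + 1]? = some c := by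
  -- Variable `x + 1` names the successor of `x`; `x + 2` ranges over the positions that must not
  -- lie between them.
  refine (((lt x (x + 1)).and ((((lt x (x + 2)).and (lt (x + 2) (x + 1))).ex (x + 2)).neg.and
    ((letter c x).and (letter c (x + 1))))).ex (x + 1)).congr fun w v hv => ?_
  simp only [Function.update_self, Function.update_of_ne, ne_eq, Nat.left_eq_add,
    Nat.add_left_cancel_iff, one_ne_zero, OfNat.ofNat_ne_zero,
    OfNat.one_ne_ofNat, not_false_eq_true]
  constructor
  · rintro ⟨i, hi, h1, h2, h3, h4⟩
    have : i = v x + 1 := by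
      by_contra hne
      exact h2 ⟨v x + 1, by omega, by omega, by omega⟩
    subst this
    exact ⟨h3, h4⟩
  · rintro ⟨h1, h2⟩
    have hlt : v x + 1 < w.length := (List.getElem?_eq_some_iff.1 h2).1
    exact ⟨v x + 1, hlt, by omega, by rintro ⟨i, -, h3, h4⟩; omega, h1, h2⟩

/-- A definable property of words is a definable language. -/
theorem foDefinable {L : Language A} (h : FORel fun w _ => w ∈ L) : FODefinable L := by
  obtain ⟨φ, hφ⟩ := h
  -- The truth of `φ` does not depend on the valuation, so all its free variables may be merged into
  -- one bound variable.
  let ψ : (orderSignature A).BoundedFormula Empty 1 :=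
    FirstOrder.Language.BoundedFormula.relabel (n := 1) (k := 0) (fun _ : ℕ => Sum.inr 0) φ
  have key : ∀ (w : List A) (i : Position w),
      ψ.Realize default (Fin.snoc default i) ↔ w ∈ L := by
    intro w i
    rw [← show _ ↔ w ∈ L from hφ w fun _ => i, FirstOrder.Language.BoundedFormula.realize_relabel,
      FirstOrder.Language.Formula.Realize]
    refine iff_of_eq ?_
    congr 1
    exact Subsingleton.elim _ _
  -- The empty word has no valuations, so `φ` says nothing about it. The quantifier in front of `ψ`
  -- is chosen to give the right value there: universal is true, existential is false.
  by_cases hnil : ([] : List A) ∈ L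
  · refine ⟨ψ.all, fun w => ?_⟩
    rw [FirstOrder.Language.Sentence.Realize, FirstOrder.Language.Formula.Realize,
      FirstOrder.Language.BoundedFormula.realize_all]
    constructor
    · exact fun hw i => (key w i).2 hw
    · intro hall
      rcases w with _ | ⟨c, w⟩
      · exact hnil
      · exact (key (c :: w) (.ofLt (Nat.succ_pos _))).1 (hall _)
  · refine ⟨ψ.ex, fun w => ?_⟩
    rw [FirstOrder.Language.Sentence.Realize, FirstOrder.Language.Formula.Realize,
      FirstOrder.Language.BoundedFormula.realize_ex]
    constructor
    · intro hw
      rcases w with _ | ⟨c, w⟩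
      · exact absurd hw hnil
      · exact ⟨_, (key (c :: w) (.ofLt (Nat.succ_pos _))).2 hw⟩
    · rintro ⟨i, hi⟩
      exact (key w i).1 hi

end FORel

/-! ### Translation of `FO²[<,Bet]` into `FO[<]` -/

theorem BetFormula.foRel {A : Type u} (φ : BetFormula A) :
    FORel fun w v => φ.Holds w fun x => v x := by
  induction φ with
  | falsum => exact FORel.falsum
  | eq x y => exact FORel.eq x y
  | lt x y => exact FORel.lt x y
  | letter a x => exact FORel.letter a x
  | between a x y =>
    -- The name `2` is fresh, since the two variables are named `0` and `1`.
    refine (((FORel.lt x 2).and ((FORel.lt 2 y).and (FORel.letter a 2))).ex 2).congr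
      fun w v _ => ?_
    have hx : (x : ℕ) ≠ 2 := by omega
    have hy : (y : ℕ) ≠ 2 := by omega
    simp only [Function.update_self, Function.update_of_ne hx, Function.update_of_ne hy, Holds]
    refine exists_congr fun z => and_iff_right_of_imp ?_
    rintro ⟨-, -, h⟩
    exact (List.getElem?_eq_some_iff.1 h).1
  | neg φ ih => exact ih.neg
  | and φ ψ ih₁ ih₂ => exact ih₁.and ih₂
  | ex x φ ih =>
    refine (ih.ex x).congr fun w v _ => ?_
    refine exists_congr fun i => and_congr_right fun _ => iff_of_eq ?_
    congr 1
    exact Function.update_comp_eq_of_injective v Fin.val_injective x i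

theorem BetDefinable.foDefinable {A : Type u} {L : Language A} (h : BetDefinable L) :
    FODefinable L := by
  obtain ⟨φ, hφ, hL⟩ := h
  refine FORel.foDefinable (φ.foRel.congr fun w v _ => ?_)
  rw [hL]
  constructor
  · intro h v'
    refine (φ.holds_congr w _ _ ?_).1 h
    rw [hφ]
    exact fun x hx => absurd hx (Finset.notMem_empty x)
  · exact fun h => h _

/-! ### The nested language -/

section Nested

variable {A : Type u} {a b : A}

theorem nestedLanguage_eq (a b : A) : nestedLanguage a b =
    KStar.kstar (({[a]} : Language A) * KStar.kstar (({[a]} : Language A) * {[b]}) * {[b]}) := rfl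

theorem nil_mem_nestedLanguage : ([] : List A) ∈ nestedLanguage a b :=
  Language.nil_mem_kstar _

theorem append_mem_kstar {K : Language A} {u v : List A} (hu : u ∈ KStar.kstar K)
    (hv : v ∈ KStar.kstar K) : u ++ v ∈ KStar.kstar K := by
  obtain ⟨S, rfl, hS⟩ := Language.mem_kstar.1 hu
  obtain ⟨S', rfl, hS'⟩ := Language.mem_kstar.1 hv
  refine Language.mem_kstar.2 ⟨S ++ S', by simp, fun y hy => ?_⟩
  rcases List.mem_append.1 hy with h | h
  exacts [hS y h, hS' y h]

theorem mem_kstar_of_mem {K : Language A} {u : List A} (hu : u ∈ K) : u ∈ KStar.kstar K :=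
  Language.mem_kstar.2 ⟨[u], by simp, by simpa using hu⟩

theorem append_mem_nestedLanguage {u v : List A} (hu : u ∈ nestedLanguage a b)
    (hv : v ∈ nestedLanguage a b) : u ++ v ∈ nestedLanguage a b :=
  append_mem_kstar hu hv

theorem pair_mem_kstar : [a, b] ∈ KStar.kstar (({[a]} : Language A) * {[b]}) :=
  mem_kstar_of_mem (Language.mem_mul.2 ⟨[a], rfl, [b], rfl, rfl⟩)

theorem cons_append_mem_nestedLanguage {u : List A}
    (hu : u ∈ KStar.kstar (({[a]} : Language A) * {[b]})) :
    a :: (u ++ [b]) ∈ nestedLanguage a b :=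
  mem_kstar_of_mem (Language.mem_mul.2
    ⟨a :: u, Language.mem_mul.2 ⟨[a], rfl, u, hu, rfl⟩, [b], rfl, rfl⟩)

theorem kstar_pair_induction {p : List A → Prop} (nil : p [])
    (step : ∀ u, p u → p (a :: b :: u)) {u : List A}
    (hu : u ∈ KStar.kstar (({[a]} : Language A) * {[b]})) : p u := by
  obtain ⟨S, rfl, hS⟩ := Language.mem_kstar.1 hu
  clear hu
  induction S with
  | nil => exact nil
  | cons x S ih =>
    obtain ⟨s, rfl, t, rfl, rfl⟩ := Language.mem_mul.1 (hS x (by simp))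
    exact step _ (ih fun y hy => hS y (by simp [hy]))

theorem nestedLanguage_induction {p : List A → Prop} (nil : p [])
    (step : ∀ u v, u ∈ KStar.kstar (({[a]} : Language A) * {[b]}) → p v →
      p (a :: (u ++ b :: v))) {w : List A} (hw : w ∈ nestedLanguage a b) : p w := by
  rw [nestedLanguage_eq] at hw
  obtain ⟨S, rfl, hS⟩ := Language.mem_kstar.1 hw
  clear hw
  induction S with
  | nil => exact nil
  | cons x S ih =>
    obtain ⟨s, hs, t, rfl, rfl⟩ := Language.mem_mul.1 (hS x (by simp))
    obtain ⟨s, rfl, t, ht, rfl⟩ := Language.mem_mul.1 hs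
    simpa using step t _ ht (ih fun y hy => hS y (by simp [hy]))

theorem kstar_pair_subset_nestedLanguage {u : List A}
    (hu : u ∈ KStar.kstar (({[a]} : Language A) * {[b]})) : u ∈ nestedLanguage a b :=
  kstar_pair_induction nil_mem_nestedLanguage (fun _ h =>
    append_mem_nestedLanguage (cons_append_mem_nestedLanguage (Language.nil_mem_kstar _)) h) hu

theorem count_eq_of_mem_nestedLanguage [DecidableEq A] (hab : a ≠ b) {w : List A}
    (hw : w ∈ nestedLanguage a b) : w.count a = w.count b := by
  refine nestedLanguage_induction (p := fun w => w.count a = w.count b) (by simp)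
    (fun u v hu hv => ?_) hw
  have hu' : u.count a = u.count b :=
    kstar_pair_induction (p := fun u => u.count a = u.count b) (by simp) (fun u h => by simp [hab, hab.symm, h]) hu
  simp [hab, hab.symm, hu', hv]
  omega

/-! ### Height profiles and first-order definability -/

/-- Reading `w` from height `s`, with `a` going up and `b` going down, the height stays between
`0` and `2` and ends at `0`. -/
def IsDescent (a b : A) : ℕ → List A → Prop
  | s, [] => s = 0
  | s, c :: w => (c = a ∧ s < 2 ∧ IsDescent a b (s + 1) w) ∨
      (c = b ∧ 0 < s ∧ IsDescent a b (s - 1) w)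

theorem isDescent_zero_iff_mem (w : List A) :
    IsDescent a b 0 w ↔ w ∈ nestedLanguage a b := by
  constructor
  -- The induction needs all three heights at once: from height 1 or 2 the rest of the word must
  -- first complete the current block `a(ab)*b`.
  · suffices H : (IsDescent a b 0 w → w ∈ nestedLanguage a b) ∧
        (IsDescent a b 1 w → ∃ u v, u ∈ KStar.kstar (({[a]} : Language A) * {[b]}) ∧
          v ∈ nestedLanguage a b ∧ w = u ++ b :: v) ∧
        (IsDescent a b 2 w → ∃ u v, u ∈ KStar.kstar (({[a]} : Language A) * {[b]}) ∧
          v ∈ nestedLanguage a b ∧ w = b :: (u ++ b :: v)) from H.1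
    induction w with
    | nil => exact ⟨fun _ => nil_mem_nestedLanguage, by simp [IsDescent], by simp [IsDescent]⟩
    | cons c w ih =>
      obtain ⟨ih0, ih1, ih2⟩ := ih
      refine ⟨fun h => ?_, fun h => ?_, fun h => ?_⟩
      · rcases h with ⟨rfl, -, h⟩ | ⟨-, h, -⟩
        · obtain ⟨u, v, hu, hv, rfl⟩ := ih1 h
          simpa using append_mem_nestedLanguage (cons_append_mem_nestedLanguage hu) hv
        · omega
      · rcases h with ⟨rfl, -, h⟩ | ⟨rfl, -, h⟩
        · obtain ⟨u, v, hu, hv, rfl⟩ := ih2 h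
          exact ⟨c :: b :: u, v, append_mem_kstar pair_mem_kstar hu, hv, rfl⟩
        · exact ⟨[], w, Language.nil_mem_kstar _, ih0 h, rfl⟩
      · rcases h with ⟨-, h, -⟩ | ⟨rfl, -, h⟩
        · omega
        · obtain ⟨u, v, hu, hv, rfl⟩ := ih1 h
          exact ⟨u, v, hu, hv, rfl⟩
  · refine nestedLanguage_induction (p := IsDescent a b 0) rfl fun u v hu hv => Or.inl ⟨rfl, by omega, ?_⟩
    refine kstar_pair_induction (p := fun u => IsDescent a b 1 (u ++ b :: v))
      (show IsDescent a b 1 (b :: v) from Or.inr ⟨rfl, by omega, hv⟩) (fun u h => ?_) hu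
    exact Or.inl ⟨rfl, by omega, Or.inr ⟨rfl, by omega, h⟩⟩

theorem isDescent_iff_exists_height (s : ℕ) (w : List A) :
    IsDescent a b s w ↔ ∃ H : ℕ → ℕ, H 0 = s ∧ H w.length = 0 ∧ ∀ i < w.length,
      (w[i]? = some a ∧ H i < 2 ∧ H (i + 1) = H i + 1) ∨
      (w[i]? = some b ∧ H i = H (i + 1) + 1) := by
  induction w generalizing s with
  | nil =>
    constructor
    · rintro rfl
      exact ⟨fun _ => 0, rfl, rfl, by simp⟩
    · rintro ⟨H, rfl, h, -⟩
      exact h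
  | cons c w ih =>
    constructor
    · intro h
      have aux : ∀ t, IsDescent a b t w → ((c = a ∧ s < 2 ∧ t = s + 1) ∨ (c = b ∧ s = t + 1)) →
          ∃ H : ℕ → ℕ, H 0 = s ∧ H (c :: w).length = 0 ∧ ∀ i < (c :: w).length,
            ((c :: w)[i]? = some a ∧ H i < 2 ∧ H (i + 1) = H i + 1) ∨
            ((c :: w)[i]? = some b ∧ H i = H (i + 1) + 1) := by
        intro t ht hst
        obtain ⟨H, h0, h1, h2⟩ := (ih t).1 ht
        refine ⟨fun i => Nat.casesOn i s H, rfl, h1, fun i hi => ?_⟩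
        rcases i with _ | i
        · simpa [h0] using hst
        · simpa using h2 i (by simpa using hi)
      rcases h with ⟨rfl, hs, h⟩ | ⟨rfl, hs, h⟩
      · exact aux _ h (Or.inl ⟨rfl, hs, rfl⟩)
      · exact aux _ h (Or.inr ⟨rfl, by omega⟩)
    · rintro ⟨H, rfl, h1, h2⟩
      have hw : IsDescent a b (H 1) w := (ih _).2 ⟨fun i => H (i + 1), rfl, h1, fun i hi => by
        simpa using h2 (i + 1) (by simpa using hi)⟩
      rcases h2 0 (by simp) with ⟨hc, hs, h⟩ | ⟨hc, h⟩
      · exact Or.inl ⟨by simpa using hc, hs, by simpa [h] using hw⟩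
      · exact Or.inr ⟨by simpa using hc, by omega, by simpa [h] using hw⟩

/-- The last factor `aa` or `bb` that ends at or before position `i` is `aa`. -/
def IsHigh (a b : A) (w : List A) (i : ℕ) : Prop :=
  ∃ j, j < w.length ∧ j < i ∧ (w[j]? = some a ∧ w[j + 1]? = some a) ∧
    ∀ k, k < w.length → j < k → k < i → ¬ (w[k]? = some b ∧ w[k + 1]? = some b)

theorem not_isHigh_zero (w : List A) : ¬ IsHigh a b w 0 := by
  rintro ⟨j, -, h, -⟩
  omega

theorem isHigh_succ (w : List A) (i : ℕ) : IsHigh a b w (i + 1) ↔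
    (w[i]? = some a ∧ w[i + 1]? = some a) ∨
      (IsHigh a b w i ∧ ¬ (w[i]? = some b ∧ w[i + 1]? = some b)) := by
  constructor
  · rintro ⟨j, h1, h2, h3, h4⟩
    rcases Nat.lt_succ_iff_lt_or_eq.1 h2 with h | rfl
    · refine Or.inr ⟨⟨j, h1, h, h3, fun k hk hjk hki => h4 k hk hjk (by omega)⟩, fun hb => ?_⟩
      exact h4 i (List.getElem?_eq_some_iff.1 hb.1).1 h (by omega) hb
    · exact Or.inl h3
  · rintro (h | ⟨⟨j, h1, h2, h3, h4⟩, h⟩)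
    · exact ⟨i, (List.getElem?_eq_some_iff.1 h.1).1, by omega, h, fun k _ _ _ => by omega⟩
    · refine ⟨j, h1, by omega, h3, fun k hk hjk hki => ?_⟩
      rcases Nat.lt_succ_iff_lt_or_eq.1 hki with h' | rfl
      exacts [h4 k hk hjk h', h]

open Classical in
/-- The height after position `i`, computed from the letter at `i` and the last double letter. -/
noncomputable def heightAfter (a b : A) (w : List A) (i : ℕ) : ℕ :=
  (if w[i]? = some a then 1 else 0) + if IsHigh a b w i then 1 else 0

/-- A height function is forced to equal `heightAfter`, by induction along the word; conversely
`heightAfter` is one as soon as no double letter leaves the range 0 to 2 and the ends are right. The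
end conditions are phrased through "no position before" and "no position after" to match first-order
formulas. -/
theorem mem_nestedLanguage_iff (hab : a ≠ b) {w : List A} (hw : 0 < w.length) :
    w ∈ nestedLanguage a b ↔
      (∀ i, i < w.length → w[i]? = some a ∨ w[i]? = some b) ∧
      (∀ i, i < w.length → ((∀ j, j < w.length → ¬ j < i) → w[i]? = some a) ∧
        ((∀ j, j < w.length → ¬ i < j) → w[i]? = some b ∧ ¬ IsHigh a b w i) ∧
        (w[i]? = some a ∧ w[i + 1]? = some a → ¬ IsHigh a b w i) ∧
        (w[i]? = some b ∧ w[i + 1]? = some b → IsHigh a b w i)) := by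
  have hsome : some a ≠ some b := fun h => hab (Option.some_injective _ h)
  rw [← isDescent_zero_iff_mem, isDescent_iff_exists_height]
  constructor
  · rintro ⟨H, h0, hlast, hstep⟩
    have hletter : ∀ i, i < w.length → w[i]? = some a ∨ w[i]? = some b := fun i hi =>
      (hstep i hi).imp And.left And.left
    have hfirst : w[0]? = some a := by
      rcases hstep 0 hw with h | h
      · exact h.1
      · omega
    have hH : ∀ i, i < w.length → H (i + 1) = heightAfter a b w i := by
      intro i
      induction i with
      | zero =>
        intro hi
        have := hstep 0 hi
        simp_all [heightAfter, not_isHigh_zero]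
      | succ i ih =>
        intro hi
        have h1 := ih (by omega)
        have h2 := hstep (i + 1) hi
        have h3 := hletter i (by omega)
        by_cases hh : IsHigh a b w i <;>
        rcases h3 with h3 | h3 <;> rcases h2 with ⟨h2, h4⟩ | ⟨h2, h4⟩ <;>
          simp [heightAfter, isHigh_succ, h2, h3, hh, hsome, hsome.symm] at h1 ⊢ <;>
          omega
    refine ⟨hletter, fun i hi => ⟨fun h => ?_, fun h => ?_, fun h => ?_, fun h => ?_⟩⟩
    · rcases i with _ | i
      · exact hfirst
      · exact absurd (Nat.succ_pos i) (h 0 hw)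
    · have : i + 1 = w.length := by
        by_contra hne
        exact h (i + 1) (by omega) (by omega)
      have h1 := hH i hi
      rw [this, hlast] at h1
      rcases hletter i hi with h3 | h3
      · simp [heightAfter, h3] at h1
        omega
      · refine ⟨h3, fun hh => ?_⟩
        simp [heightAfter, hh] at h1
    · intro hh
      have hi' := (List.getElem?_eq_some_iff.1 h.2).1
      have h1 := hH i hi
      have h2 := hstep (i + 1) hi'
      simp [heightAfter, h.1, h.2, hh, hab] at h1 h2
      omega
    · by_contra hh
      have hi' := (List.getElem?_eq_some_iff.1 h.2).1
      have h1 := hH i hi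
      have h2 := hstep (i + 1) hi'
      simp [heightAfter, h.1, h.2, hh, hab.symm] at h1 h2
      omega
  · rintro ⟨hletter, h⟩
    have hfirst : w[0]? = some a := (h 0 hw).1 fun j _ => by omega
    refine ⟨fun i => Nat.casesOn i 0 (heightAfter a b w), rfl, ?_, fun i hi => ?_⟩
    · obtain ⟨h1, h2⟩ := (h (w.length - 1) (by omega)).2.1 fun j _ => by omega
      obtain ⟨n, hn⟩ : ∃ n, w.length = n + 1 := ⟨w.length - 1, by omega⟩
      rw [hn, Nat.add_sub_cancel] at h1 h2
      rw [hn]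
      simp [heightAfter, h1, h2, hab.symm]
    · rcases i with _ | i
      · simp [heightAfter, hfirst, not_isHigh_zero]
      · obtain ⟨-, -, h3, h4⟩ := h i (by omega)
        have h5 := hletter i (by omega)
        have h6 := hletter (i + 1) hi
        by_cases hh : IsHigh a b w i <;>
        rcases h5 with h5 | h5 <;> rcases h6 with h6 | h6 <;>
          simp [heightAfter, isHigh_succ, h5, h6, hh, hab, hab.symm] at h3 h4 ⊢

theorem foDefinable_nestedLanguage (hab : a ≠ b) : FODefinable (nestedLanguage a b) := by
  have hhigh : FORel fun (w : List A) v => IsHigh a b w (v 0) := by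
    refine (((FORel.lt 1 0).and ((FORel.double a 1).and
      (((FORel.lt 1 2).imp ((FORel.lt 2 0).imp (FORel.double b 2).neg)).all 2))).ex 1).congr
      fun w v _ => ?_
    simp [IsHigh]
  have hlet := ((FORel.letter a 0).or (FORel.letter b 0)).all 0
  have hmin := ((FORel.lt (A := A) 1 0).neg.all 1).imp (FORel.letter a 0)
  have hmax := ((FORel.lt (A := A) 0 1).neg.all 1).imp ((FORel.letter b 0).and hhigh.neg)
  have hup := (FORel.double a 0).imp hhigh.neg
  have hdown := (FORel.double b 0).imp hhigh
  refine FORel.foDefinable ((hlet.and ((hmin.and (hmax.and (hup.and hdown))).all 0)).congr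
    fun w v hv => ?_)
  rw [mem_nestedLanguage_iff hab (Nat.zero_lt_of_lt (hv 0))]
  simp

end Nested


/-! ### Back-and-forth systems for `FO²[<,Bet]` -/

section Game

variable {A : Type u}

/-- The letter `z` occurs strictly between positions `p` and `k`. -/
def Between (w : List A) (z : A) (p k : ℕ) : Prop := ∃ i, p < i ∧ i < k ∧ w[i]? = some z

/-- The pairs `(p, k)` in `w` and `(p', k')` in `w'` satisfy the same binary atoms. -/
def SameAtoms (w w' : List A) (p k p' k' : ℕ) : Prop :=
  (p < k ↔ p' < k') ∧ (k < p ↔ k' < p') ∧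
    ∀ z, (Between w z p k ↔ Between w' z p' k') ∧ (Between w z k p ↔ Between w' z k' p')

theorem SameAtoms.swap {w w' : List A} {p k p' k' : ℕ} (h : SameAtoms w w' p k p' k') :
    SameAtoms w w' k p k' p' :=
  ⟨h.2.1, h.1, fun z => (h.2.2 z).symm⟩

theorem SameAtoms.symm {w w' : List A} {p k p' k' : ℕ} (h : SameAtoms w w' p k p' k') :
    SameAtoms w' w p' k' p k :=
  ⟨h.1.symm, h.2.1.symm, fun z => ⟨(h.2.2 z).1.symm, (h.2.2 z).2.symm⟩⟩

theorem SameAtoms.refl_pair (w w' : List A) (p p' : ℕ) : SameAtoms w w' p p p' p' := by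
  have h : ∀ (w : List A) (z : A) (p : ℕ), ¬ Between w z p p := by
    rintro w z p ⟨i, h1, h2, -⟩
    omega
  simp [SameAtoms, h]

/-- The quantifier depth of a formula. -/
def BetFormula.depth : BetFormula A → ℕ
  | falsum => 0
  | eq _ _ => 0
  | lt _ _ => 0
  | letter _ _ => 0
  | between _ _ _ => 0
  | neg φ => φ.depth
  | and φ ψ => max φ.depth ψ.depth
  | ex _ φ => φ.depth + 1

/-- A ranked system of pairs of positions with the back-and-forth property. -/
structure BackAndForth (w w' : List A) (S : ℕ → ℕ → ℕ → Prop) : Prop where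
  letter : ∀ {n p p'}, S n p p' → w[p]? = w'[p']?
  mono : ∀ {n p p'}, S (n + 1) p p' → S n p p'
  forth : ∀ {n p p' k}, S (n + 1) p p' → k < w.length →
    ∃ k', k' < w'.length ∧ S n k k' ∧ SameAtoms w w' p k p' k'
  back : ∀ {n p p' k'}, S (n + 1) p p' → k' < w'.length →
    ∃ k, k < w.length ∧ S n k k' ∧ SameAtoms w w' p k p' k'

theorem BackAndForth.holds_iff {w w' : List A} {S : ℕ → ℕ → ℕ → Prop}
    (hS : BackAndForth w w' S) (φ : BetFormula A) : ∀ (n : ℕ) (v v' : Fin 2 → ℕ), φ.depth ≤ n →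
      (∀ x, S n (v x) (v' x)) → (∀ x y, SameAtoms w w' (v x) (v y) (v' x) (v' y)) →
      (φ.Holds w v ↔ φ.Holds w' v') := by
  induction φ with
  | falsum => intros; rfl
  | eq x y =>
    intro n v v' _ _ h
    have h1 := (h x y).1
    have h2 := (h x y).2.1
    simp only [BetFormula.Holds]
    omega
  | lt x y => intro n v v' _ _ h; exact (h x y).1
  | letter a x =>
    intro n v v' _ h _
    simp only [BetFormula.Holds, hS.letter (h x)]
  | between a x y => intro n v v' _ _ h; exact ((h x y).2.2 a).1
  | neg φ ih => intro n v v' hn h1 h2; exact not_congr (ih n v v' hn h1 h2)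
  | and φ ψ ih₁ ih₂ =>
    intro n v v' hn h1 h2
    exact and_congr (ih₁ n v v' (le_trans (le_max_left _ _) hn) h1 h2)
      (ih₂ n v v' (le_trans (le_max_right _ _) hn) h1 h2)
  | ex x φ ih =>
    intro n v v' hn h1 h2
    obtain ⟨n, rfl⟩ : ∃ m, n = m + 1 := ⟨n - 1, by simp only [BetFormula.depth] at hn; omega⟩
    have hφ : φ.depth ≤ n := Nat.le_of_succ_le_succ hn
    -- The pebble `y` stays on the board while `x` moves, so the reply need only match atoms
    -- relative to `y`.
    obtain ⟨y, hy⟩ : ∃ y : Fin 2, ∀ z, z ≠ x ↔ z = y := ⟨1 - x, (by decide : ∀ x z : Fin 2, z ≠ x ↔ z = 1 - x) x⟩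
    have key : ∀ k k', S n k k' → SameAtoms w w' (v y) k (v' y) k' →
        (φ.Holds w (Function.update v x k) ↔ φ.Holds w' (Function.update v' x k')) := by
      intro k k' hk hyk
      refine ih n _ _ hφ (fun z => ?_) fun z z' => ?_
      · by_cases hz : z = x
        · subst hz; simpa using hk
        · simpa [Function.update_of_ne hz] using hS.mono (h1 z)
      · by_cases hz : z = x <;> by_cases hz' : z' = x
        · subst hz hz'; exact .refl_pair _ _ _ _
        · subst hz
          rw [Function.update_of_ne hz', Function.update_of_ne hz', (hy z').1 hz']
          simpa using hyk.swap
        · subst hz'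
          rw [Function.update_of_ne hz, Function.update_of_ne hz, (hy z).1 hz]
          simpa using hyk
        · simpa [Function.update_of_ne hz, Function.update_of_ne hz'] using h2 z z'
    constructor
    · rintro ⟨k, hk, hφk⟩
      obtain ⟨k', hk', hS', hat⟩ := hS.forth (h1 y) hk
      exact ⟨k', hk', (key k k' hS' hat).1 hφk⟩
    · rintro ⟨k', hk', hφk⟩
      obtain ⟨k, hk, hS', hat⟩ := hS.back (h1 y) hk'
      exact ⟨k, hk, (key k k' hS' hat).2 hφk⟩

/-! ### Words that locally look like a periodic word -/

/-- The sequence `f` has period `P`, contains only the letters `a` and `b`, and both of them occur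
in every factor of length three. -/
structure IsPattern (a b : A) (P : ℕ) (f : ℕ → A) : Prop where
  pos : 0 < P
  periodic : Function.Periodic f P
  dense : ∀ q z, (z = a ∨ z = b) ↔ ∃ i, i < 3 ∧ f (q + i) = z

/-- By periodicity every factor of `f` recurs in any interval of `P` starting points. The summand `e
* P` in the witness keeps the subtraction from truncating. -/
theorem IsPattern.exists_shift {a b : A} {P : ℕ} {f : ℕ → A} (hf : IsPattern a b P f) (q e : ℕ) :
    ∃ q', e ≤ q' ∧ q' < e + P ∧ ∀ i, f (q' + i) = f (q + i) := by
  refine ⟨e + (q + e * P - e) % P, by omega, by have := Nat.mod_lt (q + e * P - e) hf.pos; omega,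
    fun i => ?_⟩
  have he : e ≤ e * P := Nat.le_mul_of_pos_right e hf.pos
  have h : (e + (q + e * P - e) % P + i) % P = (q + i) % P := by
    rw [Nat.add_right_comm, Nat.add_mod_mod,
      show e + i + (q + e * P - e) = q + i + e * P by omega, Nat.add_mul_mod_self_right]
  rw [← hf.periodic.map_mod_nat, h, hf.periodic.map_mod_nat]

/-- The word `w` begins like `f`, ends like the prefix of `f` of length `T`, each for `D` letters,
and every factor of length `2 * r + 1` of `w` is a factor of `f`. -/
structure Resembles (f : ℕ → A) (D T r : ℕ) (w : List A) : Prop where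
  length : 2 * D ≤ w.length
  le : D ≤ T
  left : ∀ i, i < D → w[i]? = some (f i)
  right : ∀ i j, i + T = j + w.length → i < w.length → w.length ≤ i + D → w[i]? = some (f j)
  factor : ∀ p, p + 2 * r < w.length → ∃ q, ∀ i, i ≤ 2 * r → w[p + i]? = some (f (q + i))

theorem Resembles.left_eq_left {f : ℕ → A} {D T r : ℕ} {w w' : List A} (hw : Resembles f D T r w)
    (hw' : Resembles f D T r w') {i : ℕ} (hi : i < D) : w[i]? = w'[i]? := by
  rw [hw.left i hi, hw'.left i hi]

theorem Resembles.right_eq_right {f : ℕ → A} {D T r : ℕ} {w w' : List A}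
    (hw : Resembles f D T r w) (hw' : Resembles f D T r w') {i i' : ℕ}
    (h : i + w'.length = i' + w.length) (hi : i < w.length) (hD : w.length ≤ i + D) :
    w[i]? = w'[i']? := by
  have := hw.le
  rw [hw.right i (i + T - w.length) (by omega) hi hD,
    hw'.right i' (i + T - w.length) (by omega) (by omega) (by omega)]

/-- At least three positions lie strictly between, and three consecutive positions fit into a window
of length `2 * r + 1`, which is a factor of `f`. -/
theorem Resembles.between_iff {a b : A} {P : ℕ} {f : ℕ → A} (hf : IsPattern a b P f) {D T r : ℕ}
    (hr : 1 ≤ r) {w : List A} (hw : Resembles f D T r w) {p k : ℕ} (hpk : p + 3 < k)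
    (hk : k < w.length) (hrw : 2 * r < w.length) (z : A) : Between w z p k ↔ z = a ∨ z = b := by
  have key : ∀ s, s + 2 < w.length → ((z = a ∨ z = b) ↔ ∃ i, i < 3 ∧ w[s + i]? = some z) := by
    intro s hs
    obtain ⟨t, ht1, ht2, ht3⟩ : ∃ t, t ≤ s ∧ s + 2 ≤ t + 2 * r ∧ t + 2 * r < w.length := by
      by_cases h : s + 2 * r < w.length
      · exact ⟨s, by omega, by omega, h⟩
      · exact ⟨w.length - 1 - 2 * r, by omega, by omega, by omega⟩
    obtain ⟨q, hq⟩ := hw.factor t ht3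
    rw [hf.dense (q + (s - t))]
    refine exists_congr fun i => and_congr_right fun hi => ?_
    rw [show s + i = t + (s - t + i) by omega, hq _ (by omega), Option.some_inj, Nat.add_assoc]
  constructor
  · rintro ⟨i, h1, h2, h3⟩
    exact (key (i - 1) (by omega)).2 ⟨1, by omega, by rwa [Nat.sub_add_cancel (by omega)]⟩
  · intro h
    obtain ⟨i, hi, h'⟩ := (key (p + 1) (by omega)).1 h
    exact ⟨p + 1 + i, by omega, by omega, h'⟩

theorem Resembles.sameAtoms_of_far {a b : A} {P : ℕ} {f : ℕ → A} (hf : IsPattern a b P f)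
    {D T r : ℕ} (hr : 1 ≤ r) (hrD : r < D) {w w' : List A} (hw : Resembles f D T r w)
    (hw' : Resembles f D T r w') {p k p' k' : ℕ} (hpk : p + 3 < k) (hpk' : p' + 3 < k')
    (hk : k < w.length) (hk' : k' < w'.length) : SameAtoms w w' p k p' k' := by
  have h1 := hw.length
  have h2 := hw'.length
  refine ⟨by omega, by omega, fun z => ⟨?_, ?_⟩⟩
  · rw [hw.between_iff hf hr hpk hk (by omega), hw'.between_iff hf hr hpk' hk' (by omega)]
  · constructor <;> rintro ⟨i, h3, h4, -⟩ <;> omega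

/-- Two pairs with the same displacement, such that the words agree on the positions from the
first one to the second one. -/
theorem sameAtoms_of_agree {w w' : List A} {p k p' k' : ℕ} (hd : p + k' = p' + k)
    (h : ∀ i i', i + p' = i' + p → (p < i ∧ i < k ∨ k < i ∧ i < p) → w[i]? = w'[i']?) :
    SameAtoms w w' p k p' k' := by
  refine ⟨by omega, by omega, fun z => ⟨⟨?_, ?_⟩, ⟨?_, ?_⟩⟩⟩
  · rintro ⟨i, h1, h2, h3⟩
    exact ⟨i + p' - p, by omega, by omega, by rw [← h i _ (by omega) (by omega), h3]⟩
  · rintro ⟨i, h1, h2, h3⟩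
    exact ⟨i + p - p', by omega, by omega, by rw [h _ i (by omega) (by omega), h3]⟩
  · rintro ⟨i, h1, h2, h3⟩
    exact ⟨i + p' - p, by omega, by omega, by rw [← h i _ (by omega) (by omega), h3]⟩
  · rintro ⟨i, h1, h2, h3⟩
    exact ⟨i + p - p', by omega, by omega, by rw [h _ i (by omega) (by omega), h3]⟩

/-- Positions that are close to the left ends or to the right ends of the words and have the same
distance from that end, or that are far from all ends and have the same neighbourhood. -/
inductive SimilarAt (d s : ℕ) (w w' : List A) (p p' : ℕ) : Prop
  | left (h : p = p') (hd : p < d)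
  | right (h : p + w'.length = p' + w.length) (hp : p < w.length) (hd : w.length ≤ p + d)
  | middle (hp : d ≤ p) (hp' : d ≤ p') (hd : p + d < w.length) (hd' : p' + d < w'.length)
    (h : ∀ i i', i + p' = i' + p → i ≤ p + s → p ≤ i + s → w[i]? = w'[i']?)

theorem SimilarAt.symm {d s : ℕ} {w w' : List A} {p p' : ℕ} (h : SimilarAt d s w w' p p') :
    SimilarAt d s w' w p' p := by
  rcases h with ⟨h, hd⟩ | ⟨h, hp, hd⟩ | ⟨hp, hp', hd, hd', h⟩
  · exact .left h.symm (by omega)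
  · exact .right h.symm (by omega) (by omega)
  · exact .middle hp' hp hd' hd fun i i' h1 h2 h3 => (h i' i h1.symm (by omega) (by omega)).symm

section Similar

variable {a b : A} {P : ℕ} {f : ℕ → A} {D T r d d' s : ℕ} {w w' : List A}

theorem SimilarAt.letter (hd : d ≤ D) (hw : Resembles f D T r w) (hw' : Resembles f D T r w')
    {p p' : ℕ} (h : SimilarAt d s w w' p p') : w[p]? = w'[p']? := by
  rcases h with ⟨rfl, hp⟩ | ⟨h, hp, hd⟩ | ⟨hp, hp', hd, hd', h⟩
  · rw [hw.left _ (by omega), hw'.left _ (by omega)]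
  · exact hw.right_eq_right hw' h hp (by omega)
  · exact h _ _ (by omega) (by omega) (by omega)

/-- A pair that drops out of a shrinking end zone is still within the `D` letters where the words
agree, so it becomes a middle pair. -/
theorem SimilarAt.mono (hdd : d ≤ d') (hs : s ≤ d) (hdD : d' + d' ≤ D)
    (hw : Resembles f D T r w) (hw' : Resembles f D T r w') {p p' s' : ℕ} (hss : s ≤ s')
    (h : SimilarAt d' s' w w' p p') : SimilarAt d s w w' p p' := by
  have h1 := hw.length
  have h2 := hw'.length
  rcases h with ⟨rfl, hp⟩ | ⟨h, hp, hd⟩ | ⟨hp, hp', hd, hd', h⟩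
  · by_cases hpd : p < d
    · exact .left rfl hpd
    · exact .middle (by omega) (by omega) (by omega) (by omega) fun i i' h3 h4 h5 => by
        obtain rfl : i = i' := by omega
        exact hw.left_eq_left hw' (by omega)
  · by_cases hpd : w.length ≤ p + d
    · exact .right h hp hpd
    · exact .middle (by omega) (by omega) (by omega) (by omega) fun i i' h3 h4 h5 =>
        hw.right_eq_right hw' (by omega) (by omega) (by omega)
  · exact .middle (by omega) (by omega) (by omega) (by omega) fun i i' h3 h4 h5 =>
      h i i' h3 (by omega) (by omega)

/-- The strip between the zones `d` and `d'` at the right end of `w'` has width `P + 2 * r + 8`: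
enough for `P` possible shifts, a window of radius `r` and a gap of more than 3 from `p'`. A copy of
the window around `k` is found there. -/
theorem Resembles.exists_similar_right (hf : IsPattern a b P f) (hd' : d' = d + (P + 2 * r + 8))
    (hD : d' + d' ≤ D) (hs : s ≤ r) (hr : r ≤ d) (hw : Resembles f D T r w)
    (hw' : Resembles f D T r w') {k p' : ℕ} (hk : k < w.length) (hdk : d ≤ k)
    (hp' : p' + d' < w'.length) :
    ∃ k', p' + 3 < k' ∧ k' < w'.length ∧ SimilarAt d s w w' k k' := by
  have h1 := hw.length
  have h2 := hw'.length
  have h3 := hw.le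
  by_cases hkr : w.length ≤ k + d
  · exact ⟨k + w'.length - w.length, by omega, by omega, .right (by omega) hk hkr⟩
  · obtain ⟨q, hq⟩ := hw.factor (k - r) (by omega)
    obtain ⟨q', hq1, hq2, hq'⟩ := hf.exists_shift q (T - d' + 4)
    refine ⟨q' + r + w'.length - T, by omega, by omega,
      .middle (by omega) (by omega) (by omega) (by omega) fun i i' h4 h5 h6 => ?_⟩
    rw [show i = k - r + (i + r - k) by omega, hq _ (by omega), ← hq',
      hw'.right i' (q' + (i + r - k)) (by omega) (by omega) (by omega)]

theorem Resembles.exists_similar_left (hf : IsPattern a b P f) (hd' : d' = d + (P + 2 * r + 8))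
    (hD : d' + d' ≤ D) (hs : s ≤ r) (hr : r ≤ d) (hw : Resembles f D T r w)
    (hw' : Resembles f D T r w') {k p' : ℕ} (hdk : k + d < w.length)
    (hp' : d' ≤ p') (hp : p' < w'.length) :
    ∃ k', k' + 3 < p' ∧ k' < w'.length ∧ SimilarAt d s w w' k k' := by
  have h1 := hw.length
  have h2 := hw'.length
  by_cases hkd : k < d
  · exact ⟨k, by omega, by omega, .left rfl hkd⟩
  · obtain ⟨q, hq⟩ := hw.factor (k - r) (by omega)
    obtain ⟨q', hq1, hq2, hq'⟩ := hf.exists_shift q d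
    refine ⟨q' + r, by omega, by omega,
      .middle (by omega) (by omega) (by omega) (by omega) fun i i' h4 h5 h6 => ?_⟩
    rw [show i = k - r + (i + r - k) by omega, hq _ (by omega), ← hq', hw'.left i' (by omega)]
    congr 2
    omega

/-- A move more than 3 away is answered in an end strip, unless it and the old pebble lie at the
same end, in the stretch where the words agree; there it is copied. In the middle a move at distance
at most 3 is copied by displacement, which costs 3 from the radius. -/
theorem SimilarAt.forth (hf : IsPattern a b P f) (hr1 : 1 ≤ r)
    (hd' : d' = d + (P + 2 * r + 8)) (hD : d' + d' ≤ D) (hs : s + 3 ≤ r) (hr : r ≤ d)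
    (hw : Resembles f D T r w) (hw' : Resembles f D T r w') {p p' k : ℕ}
    (h : SimilarAt d' (s + 3) w w' p p') (hk : k < w.length) :
    ∃ k', k' < w'.length ∧ SimilarAt d s w w' k k' ∧ SameAtoms w w' p k p' k' := by
  have h1 := hw.length
  have h2 := hw'.length
  have hpos := hf.pos
  have far_right : p < w.length → p + 3 < k → d ≤ k → p' + d' < w'.length →
      ∃ k', k' < w'.length ∧ SimilarAt d s w w' k k' ∧ SameAtoms w w' p k p' k' := by
    intro hp hpk hdk hp'
    obtain ⟨k', hk1, hk2, hk3⟩ :=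
      hw.exists_similar_right hf hd' hD (by omega : s ≤ r) hr hw' hk hdk hp'
    exact ⟨k', hk2, hk3, hw.sameAtoms_of_far hf hr1 (by omega) hw' hpk hk1 hk hk2⟩
  have far_left : p < w.length → p' < w'.length → k + 3 < p → k + d < w.length → d' ≤ p' →
      ∃ k', k' < w'.length ∧ SimilarAt d s w w' k k' ∧ SameAtoms w w' p k p' k' := by
    intro hpw hpw' hpk hdk hp'
    obtain ⟨k', hk1, hk2, hk3⟩ :=
      hw.exists_similar_left hf hd' hD (by omega : s ≤ r) hr hw' hdk hp' hpw'
    exact ⟨k', hk2, hk3, (hw.sameAtoms_of_far hf hr1 (by omega) hw' hpk hk1 hpw hpw').swap⟩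
  rcases h with ⟨rfl, hp⟩ | ⟨h, hp, hd⟩ | ⟨hp, hp', hd, hdd, h⟩
  · by_cases hpk : p + 3 < k ∧ d ≤ k
    · exact far_right (by omega) hpk.1 hpk.2 (by omega)
    · refine ⟨k, by omega, ?_, sameAtoms_of_agree rfl fun i i' h3 h4 => ?_⟩
      · by_cases hkd : k < d
        · exact .left rfl hkd
        · exact .middle (by omega) (by omega) (by omega) (by omega) fun i i' h3 h4 h5 => by
            obtain rfl : i = i' := by omega
            exact hw.left_eq_left hw' (by omega)
      · obtain rfl : i = i' := by omega
        exact hw.left_eq_left hw' (by omega)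
  · by_cases hpk : k + 3 < p ∧ k + d < w.length
    · exact far_left hp (by omega) hpk.1 hpk.2 (by omega)
    · refine ⟨k + w'.length - w.length, by omega, ?_,
        sameAtoms_of_agree (by omega) fun i i' h3 h4 => ?_⟩
      · by_cases hkd : w.length ≤ k + d
        · exact .right (by omega) hk hkd
        · exact .middle (by omega) (by omega) (by omega) (by omega) fun i i' h3 h4 h5 =>
            hw.right_eq_right hw' (by omega) (by omega) (by omega)
      · exact hw.right_eq_right hw' (by omega) (by omega) (by omega)
  · by_cases hpk : p + 3 < k
    · exact far_right (by omega) hpk (by omega) hdd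
    by_cases hpk' : k + 3 < p
    · exact far_left (by omega) (by omega) hpk' (by omega) hp'
    · refine ⟨k + p' - p, by omega, .middle (by omega) (by omega) (by omega) (by omega)
        fun i i' h3 h4 h5 => ?_, sameAtoms_of_agree (by omega) fun i i' h3 h4 => ?_⟩
      · exact h i i' (by omega) (by omega) (by omega)
      · exact h i i' h3 (by omega) (by omega)

/-- The positions of two words that resemble the same pattern form a back-and-forth system. -/
theorem Resembles.backAndForth (hf : IsPattern a b P f) (hr : 1 ≤ r) (hw : Resembles f D T r w)
    (hw' : Resembles f D T r w') : BackAndForth w w' fun n p p' =>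
      3 * n ≤ r ∧ 2 * ((n + 1) * (P + 2 * r + 8)) ≤ D ∧
        SimilarAt ((n + 1) * (P + 2 * r + 8)) (3 * n) w w' p p' := by
  have hstep : ∀ n, (n + 1 + 1) * (P + 2 * r + 8) = (n + 1) * (P + 2 * r + 8) + (P + 2 * r + 8) :=
    fun n => Nat.succ_mul _ _
  have hbase : ∀ n, P + 2 * r + 8 ≤ (n + 1) * (P + 2 * r + 8) :=
    fun n => Nat.le_mul_of_pos_left _ (Nat.succ_pos _)
  refine ⟨?_, ?_, ?_, ?_⟩
  · rintro n p p' ⟨-, hD, h⟩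
    exact h.letter (by omega) hw hw'
  · rintro n p p' ⟨hn, hD, h⟩
    have h1 := hstep n
    have h2 := hbase n
    exact ⟨by omega, by omega,
      h.mono (by omega) (by omega) (by omega) hw hw' (by omega)⟩
  · rintro n p p' k ⟨hn, hD, h⟩ hk
    have h1 := hstep n
    have h2 := hbase n
    obtain ⟨k', hk', h3, h4⟩ := SimilarAt.forth hf hr h1 (by omega) hn (by omega) hw hw' h hk
    exact ⟨k', hk', ⟨by omega, by omega, h3⟩, h4⟩
  · rintro n p p' k ⟨hn, hD, h⟩ hk
    have h1 := hstep n
    have h2 := hbase n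
    obtain ⟨k', hk', h3, h4⟩ :=
      SimilarAt.forth hf hr h1 (by omega) hn (by omega) hw' hw h.symm hk
    exact ⟨k', hk', ⟨by omega, by omega, h3.symm⟩, h4.symm⟩

end Similar

/-- A sentence does not distinguish words that resemble the same pattern closely enough. -/
theorem Resembles.holds_iff {a b : A} {P : ℕ} {f : ℕ → A} {D T r : ℕ} {w w' : List A}
    (hf : IsPattern a b P f) (hr : 1 ≤ r) (hw : Resembles f D T r w)
    (hw' : Resembles f D T r w') (φ : BetFormula A) (hφr : 3 * φ.depth ≤ r)
    (hφD : 2 * ((φ.depth + 1) * (P + 2 * r + 8)) ≤ D) :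
    φ.Holds w (fun _ => 0) ↔ φ.Holds w' (fun _ => 0) :=
  (hw.backAndForth hf hr hw').holds_iff φ φ.depth _ _ le_rfl
    (fun _ => ⟨hφr, hφD, .left rfl (by positivity)⟩) fun _ _ => .refl_pair _ _ _ _

/-! ### The pattern `((ab)ᴺa(ab)ᴺb)^ω` -/

/-- The infinite word `((ab)ᴺa(ab)ᴺb)^ω`. -/
def pattern (a b : A) (N q : ℕ) : A :=
  if (if q % (2 * N + 1) = 2 * N then q / (2 * N + 1) else q % (2 * N + 1)) % 2 = 0 then a else b

section Pattern

variable {a b : A} {N : ℕ}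

theorem pattern_add_mul {t : ℕ} (m : ℕ) (ht : t < 2 * N) :
    pattern a b N (t + (2 * N + 1) * m) = if t % 2 = 0 then a else b := by
  have h : (t + (2 * N + 1) * m) % (2 * N + 1) = t := by
    rw [Nat.add_mul_mod_self_left, Nat.mod_eq_of_lt (by omega)]
  rw [pattern, h, if_neg ht.ne]

theorem pattern_marker (m : ℕ) :
    pattern a b N (2 * N + (2 * N + 1) * m) = if m % 2 = 0 then a else b := by
  have h : (2 * N + (2 * N + 1) * m) % (2 * N + 1) = 2 * N := by
    rw [Nat.add_mul_mod_self_left, Nat.mod_eq_of_lt (by omega)]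
  rw [pattern, h, if_pos rfl,
    Nat.add_mul_div_left _ _ (by omega), Nat.div_eq_of_lt (by omega), zero_add]

theorem pattern_periodic : Function.Periodic (pattern a b N) (2 * (2 * N + 1)) := by
  intro q
  rw [pattern, pattern, Nat.add_mul_mod_self_right, Nat.add_mul_div_right _ _ (by omega)]
  congr 2
  -- The markers alternate, so one period is two blocks: the block index grows by 2 and keeps its
  -- parity.
  split_ifs <;> simp

theorem isPattern_pattern (hab : a ≠ b) (hN : 1 ≤ N) :
    IsPattern a b (2 * (2 * N + 1)) (pattern a b N) := by
  refine ⟨by omega, pattern_periodic, fun q z => ⟨fun hz => ?_, ?_⟩⟩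
  · have hval : ∀ i, pattern a b N (q + i) = a ∨ pattern a b N (q + i) = b := fun i => by
      rw [pattern]
      split_ifs <;> simp
    suffices h : ∃ i j, i < 3 ∧ j < 3 ∧ pattern a b N (q + i) ≠ pattern a b N (q + j) by
      obtain ⟨i, j, hi, hj, hij⟩ := h
      rcases hval i with h1 | h1 <;> rcases hval j with h2 | h2 <;> rcases hz with rfl | rfl
      all_goals first
        | exact ⟨i, hi, h1⟩
        | exact ⟨j, hj, h2⟩
        | exact absurd (h1.trans h2.symm) hij
    obtain ⟨t, m, ht, rfl⟩ : ∃ t m, t < 2 * N + 1 ∧ q = t + (2 * N + 1) * m :=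
      ⟨q % (2 * N + 1), q / (2 * N + 1), Nat.mod_lt _ (by omega), (Nat.mod_add_div _ _).symm⟩
    have hm : (2 * N + 1) * (m + 1) = (2 * N + 1) * m + (2 * N + 1) := Nat.mul_succ _ _
    -- Two differing letters: neighbours inside `(ab)ᴺ`; the final `b` of a block and the `a` after
    -- its marker; or the `ab` after a marker.
    by_cases h1 : t + 1 < 2 * N
    · refine ⟨0, 1, by omega, by omega, ?_⟩
      rw [add_zero, pattern_add_mul m (by omega), Nat.add_right_comm, pattern_add_mul m h1]
      rcases Nat.mod_two_eq_zero_or_one t with h | h <;> simp [h, Nat.add_mod, hab, hab.symm]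
    by_cases h2 : t + 1 = 2 * N
    · refine ⟨0, 2, by omega, by omega, ?_⟩
      rw [add_zero, pattern_add_mul m (by omega),
        show t + (2 * N + 1) * m + 2 = 0 + (2 * N + 1) * (m + 1) by omega,
        pattern_add_mul (m + 1) (by omega), if_neg (by omega), if_pos rfl]
      exact hab.symm
    · refine ⟨1, 2, by omega, by omega, ?_⟩
      rw [show t + (2 * N + 1) * m + 1 = 0 + (2 * N + 1) * (m + 1) by omega,
        show t + (2 * N + 1) * m + 2 = 1 + (2 * N + 1) * (m + 1) by omega,
        pattern_add_mul (m + 1) (by omega), pattern_add_mul (m + 1) (by omega)]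
      simpa using hab
  · rintro ⟨i, -, rfl⟩
    rw [pattern]
    split_ifs <;> simp

/-- The prefix of length `n` of the pattern. -/
def patternPrefix (a b : A) (N n : ℕ) : List A := (List.range n).map (pattern a b N)

theorem length_patternPrefix (n : ℕ) : (patternPrefix a b N n).length = n := by
  simp [patternPrefix]

theorem getElem?_patternPrefix {n i : ℕ} (hi : i < n) :
    (patternPrefix a b N n)[i]? = some (pattern a b N i) := by
  simp [patternPrefix, hi]

theorem patternPrefix_add (m n : ℕ) : patternPrefix a b N (2 * (2 * N + 1) * m + n) =
    patternPrefix a b N (2 * (2 * N + 1) * m) ++ patternPrefix a b N n := by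
  rw [patternPrefix, List.range_add, List.map_append, List.map_map, patternPrefix, patternPrefix]
  congr 2
  funext i
  have := (pattern_periodic (a := a) (b := b) (N := N)).nat_mul m i
  rw [Function.comp_apply, ← this]
  congr 1
  simp only [Nat.cast_id]
  ring

theorem exists_patternPrefix_half_eq : ∃ u ∈ KStar.kstar (({[a]} : Language A) * {[b]}),
    patternPrefix a b N (2 * N + 1) = u ++ [a] ∧
    patternPrefix a b N (2 * (2 * N + 1)) = u ++ [a] ++ u ++ [b] := by
  have hu : ∀ M, (List.range (2 * M)).map (fun t => if t % 2 = 0 then a else b) ∈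
      KStar.kstar (({[a]} : Language A) * {[b]}) := by
    intro M
    induction M with
    | zero => exact Language.nil_mem_kstar _
    | succ M ih =>
      rw [show 2 * (M + 1) = 2 * M + 1 + 1 by ring, List.range_succ, List.range_succ]
      simpa [Nat.add_mod] using append_mem_kstar ih pair_mem_kstar
  have hhalf : ∀ m, (List.range (2 * N + 1)).map (fun t => pattern a b N (t + (2 * N + 1) * m)) =
      (List.range (2 * N)).map (fun t => if t % 2 = 0 then a else b) ++
        [if m % 2 = 0 then a else b] := by
    intro m
    rw [List.range_succ, List.map_append, List.map_singleton, pattern_marker]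
    congr 1
    exact List.map_congr_left fun t ht => pattern_add_mul m (List.mem_range.1 ht)
  refine ⟨_, hu N, ?_, ?_⟩
  · simpa [patternPrefix] using hhalf 0
  · have h0 := hhalf 0
    have h1 := hhalf 1
    simp only [mul_zero, add_zero, Nat.zero_mod, if_true, mul_one, Nat.one_mod, one_ne_zero,
      if_false] at h0 h1
    rw [patternPrefix, two_mul (2 * N + 1), List.range_add, List.map_append, List.map_map]
    rw [show pattern a b N ∘ (fun x => 2 * N + 1 + x) =
      fun t => pattern a b N (t + (2 * N + 1)) from funext fun t => by
        rw [Function.comp_apply, add_comm], h1]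
    rw [h0, List.append_assoc, List.append_assoc, List.append_assoc]

theorem patternPrefix_mem_nestedLanguage (m : ℕ) :
    patternPrefix a b N (2 * (2 * N + 1) * m) ∈ nestedLanguage a b := by
  induction m with
  | zero => exact nil_mem_nestedLanguage
  | succ m ih =>
    obtain ⟨u, hu, -, h⟩ := exists_patternPrefix_half_eq (a := a) (b := b) (N := N)
    rw [Nat.mul_succ, patternPrefix_add, h]
    refine append_mem_nestedLanguage ih ?_
    simpa using append_mem_nestedLanguage (kstar_pair_subset_nestedLanguage hu)
      (cons_append_mem_nestedLanguage hu)

/-- The pattern for `K` periods and a half, followed by the pattern for `K` periods. -/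
def brokenPattern (a b : A) (N K : ℕ) : List A :=
  patternPrefix a b N (2 * (2 * N + 1) * K + (2 * N + 1)) ++
    patternPrefix a b N (2 * (2 * N + 1) * K)

/-- Full periods and `(ab)ᴺ` are balanced, so the extra half period leaves one unmatched `a`. -/
theorem brokenPattern_notMem_nestedLanguage (hab : a ≠ b) (K : ℕ) :
    brokenPattern a b N K ∉ nestedLanguage a b := by
  classical
  intro h
  obtain ⟨u, hu, h', -⟩ := exists_patternPrefix_half_eq (a := a) (b := b) (N := N)
  have h1 := count_eq_of_mem_nestedLanguage hab h
  have h2 := count_eq_of_mem_nestedLanguage hab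
    (patternPrefix_mem_nestedLanguage (a := a) (b := b) (N := N) K)
  have h3 := count_eq_of_mem_nestedLanguage hab (kstar_pair_subset_nestedLanguage hu)
  rw [brokenPattern, patternPrefix_add, h'] at h1
  simp [hab, h2, h3] at h1

theorem resembles_patternPrefix (K : ℕ) :
    Resembles (pattern a b N) (2 * (2 * N + 1) * K) (2 * (2 * (2 * N + 1) * K)) N
      (patternPrefix a b N (2 * (2 * (2 * N + 1) * K))) := by
  refine ⟨by rw [length_patternPrefix], by omega, fun i hi => getElem?_patternPrefix (by omega),
    fun i j h1 h2 h3 => ?_, fun p hp => ⟨p, fun i hi => ?_⟩⟩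
  · rw [length_patternPrefix] at h1 h2
    obtain rfl : i = j := by omega
    exact getElem?_patternPrefix h2
  · rw [length_patternPrefix] at hp
    exact getElem?_patternPrefix (by omega)

theorem resembles_brokenPattern (K : ℕ) :
    Resembles (pattern a b N) (2 * (2 * N + 1) * K) (2 * (2 * (2 * N + 1) * K)) N
      (brokenPattern a b N K) := by
  have hper : ∀ i, pattern a b N (2 * (2 * N + 1) * K + i) = pattern a b N i := fun i => by
    rw [← (pattern_periodic (a := a) (b := b) (N := N)).nat_mul K i]
    congr 1
    simp only [Nat.cast_id]
    ring
  have hlen : (brokenPattern a b N K).length =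
      2 * (2 * N + 1) * K + (2 * N + 1) + 2 * (2 * N + 1) * K := by
    simp [brokenPattern, length_patternPrefix]
  set D := 2 * (2 * N + 1) * K with hDdef
  have hright : ∀ i j, i = D + (2 * N + 1) + j → j < D →
      (brokenPattern a b N K)[i]? = some (pattern a b N j) := by
    rintro i j rfl hj
    rw [brokenPattern, List.getElem?_append_right (by rw [length_patternPrefix]; omega),
      length_patternPrefix, ← hDdef, Nat.add_sub_cancel_left, getElem?_patternPrefix hj]
  -- The unbroken pattern continues with `(ab)ᴺb` and the broken word with `(ab)ᴺa`, so they agree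
  -- for `2 * N` more letters. Hence a window starting before the break is a factor of the pattern;
  -- later ones lie in the second copy.
  have hleft : ∀ i, i < D + (2 * N + 1) + D → i < D + (2 * N + 1) + 2 * N →
      (brokenPattern a b N K)[i]? = some (pattern a b N i) := by
    intro i hi' hi
    by_cases h : i < D + (2 * N + 1)
    · rw [brokenPattern, List.getElem?_append_left (by rwa [length_patternPrefix]),
        getElem?_patternPrefix h]
    · obtain ⟨t, rfl⟩ : ∃ t, i = D + (2 * N + 1) + t := ⟨i - (D + (2 * N + 1)), by omega⟩
      have h0 := pattern_add_mul (a := a) (b := b) (N := N) (t := t) 0 (by omega)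
      have h1 := pattern_add_mul (a := a) (b := b) (N := N) (t := t) 1 (by omega)
      rw [mul_zero, add_zero] at h0
      rw [mul_one] at h1
      rw [hright _ t rfl (by omega), add_assoc, hper, add_comm, h0, h1]
  refine ⟨by omega, by omega, fun i hi => hleft i (by omega) (by omega),
    fun i j h1 h2 h3 => ?_, fun p hp => ?_⟩
  · obtain ⟨t, rfl⟩ : ∃ t, j = D + t := ⟨j - D, by omega⟩
    rw [hper]
    exact hright i t (by omega) (by omega)
  · by_cases h : p < D + (2 * N + 1)
    · exact ⟨p, fun i hi => hleft _ (by omega) (by omega)⟩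
    · exact ⟨p - (D + (2 * N + 1)), fun i hi => hright _ _ (by omega) (by omega)⟩

end Pattern

theorem not_betDefinable_nestedLanguage {a b : A} (hab : a ≠ b) :
    ¬ BetDefinable (nestedLanguage a b) := by
  rintro ⟨φ, hφ, hL⟩
  have hL' : ∀ w, w ∈ nestedLanguage a b ↔ φ.Holds w fun _ => 0 := by
    refine fun w => (hL w).trans ⟨fun h => h _, fun h v => (φ.holds_congr w _ _ ?_).1 h⟩
    rw [hφ]
    exact fun x hx => absurd hx (Finset.notMem_empty x)
  -- The radius `N` pays 3 per quantifier; `Q` is the zone increment `P + 2 * r + 8` for `P = 2 * (2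
  -- * N + 1)` and `r = N`; and `K` periods are at least as long as the required `D`.
  let N := 3 * φ.depth + 1
  let Q := 2 * (2 * N + 1) + 2 * N + 8
  let K := 2 * ((φ.depth + 1) * Q)
  refine brokenPattern_notMem_nestedLanguage (N := N) hab K ?_
  have hmem : patternPrefix a b N (2 * (2 * (2 * N + 1) * K)) ∈ nestedLanguage a b := by
    rw [show 2 * (2 * (2 * N + 1) * K) = 2 * (2 * N + 1) * (2 * K) by ring]
    exact patternPrefix_mem_nestedLanguage _
  rw [hL'] at hmem ⊢
  exact ((resembles_patternPrefix K).holds_iff (isPattern_pattern hab (by omega)) (by omega)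
    (resembles_brokenPattern K) φ (by omega) (Nat.le_mul_of_pos_left K (by omega))).1 hmem

end Game

end WordLogic

theorem corollary5 :
    (∀ (A : Type u) [Finite A] (a b : A), a ≠ b →
      WordLogic.FODefinable (WordLogic.nestedLanguage a b) ∧
        ¬ WordLogic.BetDefinable (WordLogic.nestedLanguage a b)) ∧
    (∀ (A : Type u) [Finite A],
      {L : Language A | WordLogic.BetDefinable L} ⊆ {L : Language A | WordLogic.FODefinable L}) ∧
    (∀ (A : Type u) [Finite A] [Nontrivial A],
      {L : Language A | WordLogic.BetDefinable L} ⊂ {L : Language A | WordLogic.FODefinable L}) := by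
  refine ⟨fun A _ a b hab => ⟨WordLogic.foDefinable_nestedLanguage hab,
    WordLogic.not_betDefinable_nestedLanguage hab⟩, fun A _ L hL => hL.foDefinable, fun A _ _ => ?_⟩
  obtain ⟨a, b, hab⟩ := exists_pair_ne A
  refine (Set.ssubset_iff_of_subset fun L hL => hL.foDefinable).2
    ⟨WordLogic.nestedLanguage a b, WordLogic.foDefinable_nestedLanguage hab,
      WordLogic.not_betDefinable_nestedLanguage hab⟩
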